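/- For $n\times n$ complex Hermitian positive semidefinite matrices $A,B$ let $A^{1/2}$ denote the positive semidefinite square root of $A$ and let $$d(A,B)=\left[\operatorname{tr}A+\operatorname{tr}B-2\operatorname{tr}\left(A^{1/2}BA^{1/2}\right)^{1/2}\right]^{1/2}$$ be the Bures–Wasserstein distance. Let $A_1,\ldots,A_m$ be $n\times n$ complex Hermitian positive definite matrices and let $w=(w_1,\ldots,w_m)$ be a weight vector, i.e. $w_j>0$ for all $j$ and $\sum_{j=1}^m w_j=1$. Then the problem of minimising $$\sum_{j=1}^m w_j\,d^2(X,A_j)$$ over all $n\times n$ positive definite matrices $X$ has a unique solution $\Omega(w;A_1,\ldots,A_m)$ (the Wasserstein barycentre of $A_1,\ldots,A_m$ with weights $w$), and this $\Omega(w;A_1,\ldots,A_m)$ is also the unique positive definite solution of the nonlinear matrix equation $$X=\sum_{j=1}^m w_j\left(X^{1/2}A_jX^{1/2}\right)^{1/2}.$$ -/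

import Mathlib

open scoped MatrixOrder ComplexOrder

noncomputable section

/-- The positive semidefinite square root of a positive semidefinite complex matrix. -/
def psdSqrt {n : ℕ} (A : Matrix (Fin n) (Fin n) ℂ) : Matrix (Fin n) (Fin n) ℂ :=
  CFC.sqrt A

/-- `psdSqrt A` is positive semidefinite and, for positive semidefinite `A`, squares to `A`;
it is the only such matrix. -/
theorem psdSqrt_spec {n : ℕ} {A : Matrix (Fin n) (Fin n) ℂ} (hA : A.PosSemidef) :
    (psdSqrt A).PosSemidef ∧ psdSqrt A * psdSqrt A = A ∧
      ∀ B : Matrix (Fin n) (Fin n) ℂ, B.PosSemidef → B * B = A → B = psdSqrt A := by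
  have h0 : 0 ≤ A := hA.nonneg
  refine ⟨Matrix.nonneg_iff_posSemidef.1 (CFC.sqrt_nonneg A), CFC.sqrt_mul_sqrt_self A h0, ?_⟩
  intro B hB hBA
  exact (CFC.sqrt_unique hBA hB.nonneg).symm

/-- The Bures–Wasserstein distance
`d(A, B) = [tr A + tr B - 2 tr (A^{1/2} B A^{1/2})^{1/2}]^{1/2}`. The traces are real for
positive semidefinite `A`, `B`, which is why real parts are taken. -/
def buresDist {n : ℕ} (A B : Matrix (Fin n) (Fin n) ℂ) : ℝ :=
  Real.sqrt (A.trace.re + B.trace.re -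
    2 * (psdSqrt (psdSqrt A * B * psdSqrt A)).trace.re)

/-- The objective function `X ↦ ∑ⱼ wⱼ d²(X, Aⱼ)`. -/
def barycentreObjective {n m : ℕ} (w : Fin m → ℝ) (A : Fin m → Matrix (Fin n) (Fin n) ℂ)
    (X : Matrix (Fin n) (Fin n) ℂ) : ℝ :=
  ∑ j, w j * buresDist X (A j) ^ 2

/-- `X` solves the problem of minimising `∑ⱼ wⱼ d²(X, Aⱼ)` over positive definite `X`. -/
def IsWassersteinBarycentre {n m : ℕ} (w : Fin m → ℝ)
    (A : Fin m → Matrix (Fin n) (Fin n) ℂ) (X : Matrix (Fin n) (Fin n) ℂ) : Prop :=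
  X.PosDef ∧ ∀ Y : Matrix (Fin n) (Fin n) ℂ, Y.PosDef →
    barycentreObjective w A X ≤ barycentreObjective w A Y

/-- `X` is a positive definite solution of `X = ∑ⱼ wⱼ (X^{1/2} Aⱼ X^{1/2})^{1/2}`. -/
def IsBarycentreEquationSolution {n m : ℕ} (w : Fin m → ℝ)
    (A : Fin m → Matrix (Fin n) (Fin n) ℂ) (X : Matrix (Fin n) (Fin n) ℂ) : Prop :=
  X.PosDef ∧ X = ∑ j, w j • psdSqrt (psdSqrt X * A j * psdSqrt X)

end

/-! The argument is a convex duality resting on a variational bound for the fidelity F(X, A) = tr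
(X^{1/2} A X^{1/2})^{1/2}: for every positive definite Z, 2 F(X, A) ≤ tr (XZ) + tr (AZ⁻¹), with
equality exactly when Z X Z = A (`two_mul_fidelity_le`, `two_mul_fidelity_eq_iff`).

The barycentre equation for X says that the Zⱼ with Zⱼ X Zⱼ = Aⱼ satisfy ∑ wⱼ Zⱼ = 1. These Zⱼ form
a dual certificate: since tr Y = ∑ wⱼ tr (Y Zⱼ), the objective at Y minus that at X is the weighted
sum of the gaps in the bounds for (Y, Aⱼ, Zⱼ). Hence X is a minimiser, and any other minimiser Y has
Zⱼ Y Zⱼ = Aⱼ = Zⱼ X Zⱼ, so Y = X. Uniqueness for the equation follows, as every solution is a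
minimiser.

It remains to solve the equation. The dual problem, minimising ∑ wⱼ tr (Aⱼ Zⱼ⁻¹) subject to ∑ wⱼ Zⱼ
= 1, has a solution by compactness, and stationarity there makes all Zⱼ⁻¹ Aⱼ Zⱼ⁻¹ equal; their
common value is X. -/

open scoped Matrix MatrixOrder ComplexOrder
open Filter Topology

/-! ### Positive definite matrices: perturbation and trace inequalities -/

section PosDef

variable {n : ℕ}

open scoped Matrix.Norms.L2Operator in
/-- A positive definite matrix dominates a positive multiple of the identity. -/
theorem Matrix.PosDef.exists_pos_algebraMap_le {Z : Matrix (Fin n) (Fin n) ℂ} (hZ : Z.PosDef) :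
    ∃ r : ℝ, 0 < r ∧ algebraMap ℝ (Matrix (Fin n) (Fin n) ℂ) r ≤ Z := by
  rcases subsingleton_or_nontrivial (Matrix (Fin n) (Fin n) ℂ) with h | h
  · exact ⟨1, one_pos, (Subsingleton.elim _ _).le⟩
  · exact (CFC.exists_pos_algebraMap_le_iff hZ.isHermitian).2 fun x hx ↦
      (Matrix.isStrictlyPositive_iff_posDef.2 hZ).spectrum_pos hx

open scoped Matrix.Norms.L2Operator in
/-- Positive definiteness is stable under small Hermitian perturbations. -/
theorem Matrix.PosDef.eventually_add_smul {Z H : Matrix (Fin n) (Fin n) ℂ}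
    (hZ : Z.PosDef) (hH : H.IsHermitian) : ∀ᶠ t : ℝ in 𝓝 0, (Z + t • H).PosDef := by
  obtain ⟨r, hr, hrZ⟩ := hZ.exists_pos_algebraMap_le
  have hlim : Tendsto (fun t : ℝ ↦ ‖t • H‖) (𝓝 0) (𝓝 0) := by
    have : Continuous fun t : ℝ ↦ ‖t • H‖ := by fun_prop
    simpa using this.tendsto 0
  filter_upwards [hlim.eventually (gt_mem_nhds hr)] with t ht
  have hsa : IsSelfAdjoint (t • H) := IsSelfAdjoint.smul (IsSelfAdjoint.all t) hH
  have h1 := hsa.neg_algebraMap_norm_le_self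
  have h2 : algebraMap ℝ (Matrix (Fin n) (Fin n) ℂ) (r - ‖t • H‖) ≤ Z + t • H := by
    rw [map_sub, sub_eq_add_neg]
    exact add_le_add hrZ h1
  have h3 : (algebraMap ℝ (Matrix (Fin n) (Fin n) ℂ) (r - ‖t • H‖)).PosDef := by
    rw [Algebra.algebraMap_eq_smul_one]
    exact Matrix.PosDef.one.smul (sub_pos.2 ht)
  have h4 := h3.add_posSemidef (Matrix.le_iff.1 h2)
  rwa [add_sub_cancel] at h4

theorem Matrix.isClosed_setOf_posSemidef :
    IsClosed {M : Matrix (Fin n) (Fin n) ℂ | M.PosSemidef} := by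
  simp only [Matrix.posSemidef_iff_dotProduct_mulVec, Set.ofPred_and, Set.ofPred_forall]
  refine IsClosed.inter ?_ (isClosed_iInter fun x ↦ ?_)
  · exact isClosed_eq (Continuous.matrix_conjTranspose continuous_id) continuous_id
  · exact isClosed_le continuous_const
      (continuous_const.dotProduct (continuous_id.matrix_mulVec continuous_const))

theorem Matrix.PosSemidef.exists_isHermitian_mul_self {M : Matrix (Fin n) (Fin n) ℂ}
    (hM : M.PosSemidef) : ∃ E : Matrix (Fin n) (Fin n) ℂ, Eᴴ = E ∧ E * E = M :=
  ⟨psdSqrt M, (psdSqrt_spec hM).1.isHermitian, (psdSqrt_spec hM).2.1⟩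

theorem Matrix.PosSemidef.re_trace_nonneg {M : Matrix (Fin n) (Fin n) ℂ} (hM : M.PosSemidef) :
    0 ≤ M.trace.re :=
  (Complex.le_def.1 hM.trace_nonneg).1

/-- Writing M = E² with E Hermitian, 2|xy| ≤ |x|² + |y|² bounds an entry by the mean of two diagonal
entries. Trace bounds thus give boundedness. -/
theorem Matrix.PosSemidef.norm_apply_le_re_trace {M : Matrix (Fin n) (Fin n) ℂ}
    (hM : M.PosSemidef) (i j : Fin n) : ‖M i j‖ ≤ M.trace.re := by
  obtain ⟨E, hE, hEM⟩ := hM.exists_isHermitian_mul_self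
  have hsymm : ∀ a b, E b a = star (E a b) := fun a b ↦ by
    rw [← Matrix.conjTranspose_apply, hE]
  have hnorm : ∀ a b, ‖E b a‖ = ‖E a b‖ := fun a b ↦ by rw [hsymm a b, norm_star]
  have hdiag : ∀ a, (M a a).re = ∑ k, ‖E a k‖ ^ 2 := fun a ↦ by
    rw [← hEM, Matrix.mul_apply, Complex.re_sum]
    refine Finset.sum_congr rfl fun k _ ↦ ?_
    rw [hsymm a k, Complex.star_def, Complex.mul_conj, Complex.ofReal_re, Complex.normSq_eq_norm_sq]
  have htr : M.trace.re = ∑ a, (M a a).re := by simp [Matrix.trace]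
  have hle : ∀ a, (M a a).re ≤ M.trace.re := fun a ↦ by
    rw [htr]
    exact Finset.single_le_sum (f := fun a ↦ (M a a).re)
      (fun b _ ↦ by rw [hdiag b]; positivity) (Finset.mem_univ a)
  have hij : ‖M i j‖ ≤ ((M i i).re + (M j j).re) / 2 := by
    rw [hdiag i, hdiag j, ← Finset.sum_add_distrib, Finset.sum_div, ← hEM, Matrix.mul_apply]
    refine norm_sum_le_of_le _ fun k _ ↦ ?_
    rw [norm_mul, hnorm j k]
    nlinarith [sq_nonneg (‖E i k‖ - ‖E j k‖)]
  linarith [hle i, hle j]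

theorem Matrix.PosSemidef.re_trace_mul_nonneg {P Q : Matrix (Fin n) (Fin n) ℂ}
    (hP : P.PosSemidef) (hQ : Q.PosSemidef) : 0 ≤ (P * Q).trace.re := by
  obtain ⟨E, hE, hEQ⟩ := hQ.exists_isHermitian_mul_self
  have h : (P * Q).trace = (Eᴴ * P * E).trace := by
    rw [← hEQ, hE, Matrix.mul_assoc E, Matrix.trace_mul_comm E, Matrix.mul_assoc]
  rw [h]
  exact (hP.conjTranspose_mul_mul_same E).re_trace_nonneg

/-- The quadratic form `D ↦ tr (Dᴴ P D)` of a positive definite matrix `P` is definite. -/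
theorem Matrix.PosDef.eq_zero_of_re_trace {P D : Matrix (Fin n) (Fin n) ℂ} (hP : P.PosDef)
    (h : (Dᴴ * P * D).trace.re = 0) : D = 0 := by
  have hps := hP.posSemidef.conjTranspose_mul_mul_same D
  have h0 : (Dᴴ * P * D).trace = 0 :=
    Complex.ext h (Complex.le_def.1 hps.trace_nonneg).2.symm
  obtain ⟨E, hE, hEP⟩ := hP.posSemidef.exists_isHermitian_mul_self
  have h1 : Dᴴ * P * D = (E * D)ᴴ * (E * D) := by
    rw [Matrix.conjTranspose_mul, hE, ← hEP]
    simp only [Matrix.mul_assoc]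
  rw [h1, Matrix.trace_conjTranspose_mul_self_eq_zero_iff] at h0
  have h2 : P * D = 0 := by rw [← hEP, Matrix.mul_assoc, h0, Matrix.mul_zero]
  exact hP.isUnit.mul_right_eq_zero.1 h2

theorem Matrix.PosDef.mul_inv {Z : Matrix (Fin n) (Fin n) ℂ} (hZ : Z.PosDef) : Z * Z⁻¹ = 1 :=
  Matrix.mul_nonsing_inv Z ((Matrix.isUnit_iff_isUnit_det Z).1 hZ.isUnit)

theorem Matrix.PosDef.inv_mul {Z : Matrix (Fin n) (Fin n) ℂ} (hZ : Z.PosDef) : Z⁻¹ * Z = 1 :=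
  Matrix.nonsing_inv_mul Z ((Matrix.isUnit_iff_isUnit_det Z).1 hZ.isUnit)

/-- Congruence by an invertible Hermitian matrix preserves positive definiteness. -/
theorem Matrix.PosDef.mul_mul_self {C Z : Matrix (Fin n) (Fin n) ℂ} (hC : C.PosDef)
    (hZ : Z.PosDef) : (C * Z * C).PosDef := by
  have h := (Matrix.IsUnit.posDef_star_left_conjugate_iff hC.isUnit).2 hZ
  rwa [Matrix.star_eq_conjTranspose, hC.isHermitian.eq] at h

theorem psdSqrt_posDef {X : Matrix (Fin n) (Fin n) ℂ} (hX : X.PosDef) : (psdSqrt X).PosDef := by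
  obtain ⟨h1, h2, -⟩ := psdSqrt_spec hX.posSemidef
  refine h1.posDef_iff_isUnit.2 ?_
  have : IsUnit (psdSqrt X * psdSqrt X) := by rw [h2]; exact hX.isUnit
  exact ((Commute.refl _).isUnit_mul_iff.1 this).1

end PosDef

/-! ### Variational characterisation of the fidelity -/

section Fidelity

variable {n : ℕ}

/-- The fidelity `tr (X^{1/2} A X^{1/2})^{1/2}`. -/
noncomputable def fidelity (X A : Matrix (Fin n) (Fin n) ℂ) : ℝ :=
  (psdSqrt (psdSqrt X * A * psdSqrt X)).trace.re

variable {X A Z : Matrix (Fin n) (Fin n) ℂ}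

theorem psdSqrt_mul_mul_posDef (hX : X.PosDef) (hA : A.PosDef) :
    (psdSqrt (psdSqrt X * A * psdSqrt X)).PosDef :=
  psdSqrt_posDef ((psdSqrt_posDef hX).mul_mul_self hA)

/-- If `Z X Z = A` then `X^{1/2} Z X^{1/2}` is the square root of `X^{1/2} A X^{1/2}`. -/
theorem psdSqrt_mul_mul_eq (hX : X.PosDef) (hZ : Z.PosDef) (h : Z * X * Z = A) :
    psdSqrt (psdSqrt X * A * psdSqrt X) = psdSqrt X * Z * psdSqrt X := by
  have hC := psdSqrt_posDef hX
  have hCC := (psdSqrt_spec hX.posSemidef).2.1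
  set C := psdSqrt X
  have hW : (C * Z * C).PosDef := hC.mul_mul_self hZ
  have hWW : C * Z * C * (C * Z * C) = C * A * C := by
    rw [← h, ← hCC]; simp only [Matrix.mul_assoc]
  have hps : (C * A * C).PosSemidef := by
    rw [← hWW]
    have := Matrix.posSemidef_conjTranspose_mul_self (C * Z * C)
    rwa [hW.isHermitian.eq] at this
  exact ((psdSqrt_spec hps).2.2 _ hW.posSemidef hWW).symm

/-- With `W = X^{1/2} Z X^{1/2}` and `S = (X^{1/2} A X^{1/2})^{1/2}`, the gap in the variational
bound for the fidelity is `tr ((W - S) W⁻¹ (W - S))`. -/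
theorem fidelity_gap (hX : X.PosDef) (hA : A.PosDef) (hZ : Z.PosDef) :
    (X * Z).trace.re + (A * Z⁻¹).trace.re - 2 * fidelity X A =
      ((psdSqrt X * Z * psdSqrt X - psdSqrt (psdSqrt X * A * psdSqrt X))ᴴ *
        (psdSqrt X * Z * psdSqrt X)⁻¹ *
        (psdSqrt X * Z * psdSqrt X - psdSqrt (psdSqrt X * A * psdSqrt X))).trace.re := by
  have hC := psdSqrt_posDef hX
  have hS := psdSqrt_mul_mul_posDef hX hA
  have hCC := (psdSqrt_spec hX.posSemidef).2.1
  have hSS := (psdSqrt_spec (hC.mul_mul_self hA).posSemidef).2.1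
  rw [fidelity]
  set C := psdSqrt X
  set S := psdSqrt (C * A * C)
  have hW : (C * Z * C).PosDef := hC.mul_mul_self hZ
  have hinv : (C * Z * C)⁻¹ = C⁻¹ * Z⁻¹ * C⁻¹ := by
    rw [Matrix.mul_inv_rev, Matrix.mul_inv_rev, Matrix.mul_assoc]
  have h1 : (X * Z).trace = (C * Z * C).trace := by
    rw [Matrix.trace_mul_comm (C * Z), ← Matrix.mul_assoc, hCC]
  have h2 : (A * Z⁻¹).trace = (S * (C * Z * C)⁻¹ * S).trace := by
    rw [Matrix.trace_mul_comm (S * _), ← Matrix.mul_assoc, hSS, hinv]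
    calc (A * Z⁻¹).trace = (A * (C * C⁻¹) * Z⁻¹ * (C⁻¹ * C)).trace := by
          rw [hC.mul_inv, hC.inv_mul, Matrix.mul_one, Matrix.mul_one]
      _ = (A * (C * C⁻¹) * Z⁻¹ * C⁻¹ * C).trace := by rw [← Matrix.mul_assoc _ C⁻¹ C]
      _ = (C * (A * (C * C⁻¹) * Z⁻¹ * C⁻¹)).trace := Matrix.trace_mul_comm _ _
      _ = _ := by simp only [Matrix.mul_assoc]
  rw [Matrix.conjTranspose_sub, hW.isHermitian.eq, hS.isHermitian.eq, h1, h2]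
  generalize hWdef : C * Z * C = W at hW ⊢
  have h3 : (W - S) * W⁻¹ * (W - S) = W - S - S + S * W⁻¹ * S := by
    rw [Matrix.sub_mul, hW.mul_inv, Matrix.sub_mul, Matrix.one_mul, Matrix.mul_sub,
      Matrix.mul_assoc S W⁻¹ W, hW.inv_mul, Matrix.mul_one]
    abel
  rw [h3]
  simp only [Matrix.trace_add, Matrix.trace_sub, Complex.add_re, Complex.sub_re]
  ring

theorem two_mul_fidelity_le (hX : X.PosDef) (hA : A.PosDef) (hZ : Z.PosDef) :
    2 * fidelity X A ≤ (X * Z).trace.re + (A * Z⁻¹).trace.re := by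
  rw [← sub_nonneg, fidelity_gap hX hA hZ]
  exact (((psdSqrt_posDef hX).mul_mul_self hZ).inv.posSemidef.conjTranspose_mul_mul_same
    _).re_trace_nonneg

/-- The gap is a definite quadratic form in W - S, so it vanishes only if W = S; squaring this and
cancelling X^{1/2} on both sides leaves Z X Z = A. -/
theorem two_mul_fidelity_eq_iff (hX : X.PosDef) (hA : A.PosDef) (hZ : Z.PosDef) :
    2 * fidelity X A = (X * Z).trace.re + (A * Z⁻¹).trace.re ↔ Z * X * Z = A := by
  have hgap := fidelity_gap hX hA hZ
  have hC := psdSqrt_posDef hX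
  refine ⟨fun h ↦ ?_, fun h ↦ ?_⟩
  · have hD := (hC.mul_mul_self hZ).inv.eq_zero_of_re_trace (hgap.symm.trans (by linarith))
    have hCC := (psdSqrt_spec hX.posSemidef).2.1
    have hSS := (psdSqrt_spec (hC.mul_mul_self hA).posSemidef).2.1
    rw [← sub_eq_zero.1 hD] at hSS
    set C := psdSqrt X
    have h1 : C * (Z * X * Z * C) = C * (A * C) := by
      rw [← hCC]; simpa only [Matrix.mul_assoc] using hSS
    exact hC.isUnit.mul_right_cancel (hC.isUnit.mul_left_cancel h1)
  · rw [psdSqrt_mul_mul_eq hX hZ h, sub_self, Matrix.mul_zero, Matrix.trace_zero,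
      Complex.zero_re] at hgap
    linarith

/-- The variational bound at Z = 1 shows that the radicand is nonnegative, so the real square root
does not truncate it. -/
theorem buresDist_sq (hX : X.PosDef) (hA : A.PosDef) :
    buresDist X A ^ 2 = X.trace.re + A.trace.re - 2 * fidelity X A := by
  have h := two_mul_fidelity_le hX hA Matrix.PosDef.one
  rw [inv_one, Matrix.mul_one, Matrix.mul_one] at h
  exact Real.sq_sqrt (sub_nonneg.2 h)

end Fidelity

/-! ### Solutions of the equation as unique minimisers -/

section Barycentre

variable {n m : ℕ} {w : Fin m → ℝ} {A : Fin m → Matrix (Fin n) (Fin n) ℂ}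
  {X Y : Matrix (Fin n) (Fin n) ℂ}

/-- The barycentre equation says that the matrices `Zⱼ` with `Zⱼ X Zⱼ = Aⱼ` average to `1`. -/
theorem isBarycentreEquationSolution_iff (hA : ∀ j, (A j).PosDef) :
    IsBarycentreEquationSolution w A X ↔ X.PosDef ∧ ∃ Z : Fin m → Matrix (Fin n) (Fin n) ℂ,
      (∀ j, (Z j).PosDef) ∧ (∀ j, Z j * X * Z j = A j) ∧ ∑ j, w j • Z j = 1 := by
  refine and_congr_right fun hX ↦ ?_
  have hC := psdSqrt_posDef hX
  have hCC := (psdSqrt_spec hX.posSemidef).2.1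
  constructor
  · intro h
    have hSS := fun j ↦ (psdSqrt_spec (hC.mul_mul_self (hA j)).posSemidef).2.1
    have hS := fun j ↦ psdSqrt_mul_mul_posDef hX (hA j)
    set C := psdSqrt X
    -- The witness solves C Zⱼ C = (C Aⱼ C)^{1/2} for Zⱼ.
    refine ⟨fun j ↦ C⁻¹ * psdSqrt (C * A j * C) * C⁻¹, fun j ↦ hC.inv.mul_mul_self (hS j),
      fun j ↦ ?_, ?_⟩
    · calc _ = C⁻¹ * psdSqrt (C * A j * C) * (C⁻¹ * C) * (C * C⁻¹) *
            psdSqrt (C * A j * C) * C⁻¹ := by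
            rw [← hCC]; simp only [Matrix.mul_assoc]
        _ = C⁻¹ * (psdSqrt (C * A j * C) * psdSqrt (C * A j * C)) * C⁻¹ := by
            rw [hC.mul_inv, hC.inv_mul]; simp only [Matrix.mul_assoc, Matrix.one_mul]
        _ = (C⁻¹ * C) * A j * (C * C⁻¹) := by rw [hSS]; simp only [Matrix.mul_assoc]
        _ = A j := by rw [hC.mul_inv, hC.inv_mul, Matrix.one_mul, Matrix.mul_one]
    · calc _ = C⁻¹ * (∑ j, w j • psdSqrt (C * A j * C)) * C⁻¹ := by
            simp only [Matrix.mul_sum, Matrix.sum_mul, Matrix.mul_smul, Matrix.smul_mul]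
        _ = (C⁻¹ * C) * (C * C⁻¹) := by rw [← h, ← hCC]; simp only [Matrix.mul_assoc]
        _ = 1 := by rw [hC.mul_inv, hC.inv_mul, Matrix.mul_one]
  · rintro ⟨Z, hZ, hZX, hsum⟩
    have hS := fun j ↦ psdSqrt_mul_mul_eq hX (hZ j) (hZX j)
    simp only [hS]
    calc X = psdSqrt X * (∑ j, w j • Z j) * psdSqrt X := by rw [hsum, Matrix.mul_one, hCC]
      _ = _ := by simp only [Matrix.mul_sum, Matrix.sum_mul, Matrix.mul_smul, Matrix.smul_mul]

theorem barycentreObjective_eq (hw1 : ∑ j, w j = 1) (hA : ∀ j, (A j).PosDef) (hX : X.PosDef) :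
    barycentreObjective w A X =
      X.trace.re + ∑ j, w j * (A j).trace.re - ∑ j, w j * (2 * fidelity X (A j)) := by
  have h : X.trace.re = ∑ j, w j * X.trace.re := by rw [← Finset.sum_mul, hw1, one_mul]
  rw [h, ← Finset.sum_add_distrib, ← Finset.sum_sub_distrib]
  refine Finset.sum_congr rfl fun j _ ↦ ?_
  rw [buresDist_sq hX (hA j)]
  ring

theorem re_trace_eq_sum {Z : Fin m → Matrix (Fin n) (Fin n) ℂ} (hsum : ∑ j, w j • Z j = 1) :
    X.trace.re = ∑ j, w j * (X * Z j).trace.re := by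
  conv_lhs => rw [← Matrix.mul_one X, ← hsum]
  simp [Matrix.mul_sum, Matrix.trace_sum]

/-- A solution of the barycentre equation minimises the objective, and it is the only
minimiser. -/
theorem IsBarycentreEquationSolution.isWassersteinBarycentre_and_unique
    (hw : ∀ j, 0 < w j) (hw1 : ∑ j, w j = 1) (hA : ∀ j, (A j).PosDef)
    (hX : IsBarycentreEquationSolution w A X) :
    IsWassersteinBarycentre w A X ∧ ∀ Y, IsWassersteinBarycentre w A Y → Y = X := by
  obtain ⟨hXp, Z, hZ, hZX, hsum⟩ := (isBarycentreEquationSolution_iff hA).1 hX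
  have hval : barycentreObjective w A X =
      ∑ j, w j * (A j).trace.re - ∑ j, w j * (A j * (Z j)⁻¹).trace.re := by
    rw [barycentreObjective_eq hw1 hA hXp, re_trace_eq_sum hsum]
    simp only [fun j ↦ (two_mul_fidelity_eq_iff hXp (hA j) (hZ j)).2 (hZX j), mul_add,
      Finset.sum_add_distrib]
    ring
  have hgap : ∀ Y : Matrix (Fin n) (Fin n) ℂ, Y.PosDef →
      barycentreObjective w A Y - barycentreObjective w A X =
        ∑ j, w j * ((Y * Z j).trace.re + (A j * (Z j)⁻¹).trace.re - 2 * fidelity Y (A j)) := by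
    intro Y hY
    rw [hval, barycentreObjective_eq hw1 hA hY, re_trace_eq_sum hsum]
    simp only [mul_sub, mul_add, Finset.sum_add_distrib, Finset.sum_sub_distrib]
    ring
  have hterm : ∀ Y : Matrix (Fin n) (Fin n) ℂ, Y.PosDef → ∀ j,
      0 ≤ w j * ((Y * Z j).trace.re + (A j * (Z j)⁻¹).trace.re - 2 * fidelity Y (A j)) :=
    fun Y hY j ↦ mul_nonneg (hw j).le (sub_nonneg.2 (two_mul_fidelity_le hY (hA j) (hZ j)))
  refine ⟨⟨hXp, fun Y hY ↦ ?_⟩, fun Y ⟨hY, hYmin⟩ ↦ ?_⟩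
  · rw [← sub_nonneg, hgap Y hY]
    exact Finset.sum_nonneg fun j _ ↦ hterm Y hY j
  · have h0 : ∑ j, w j *
        ((Y * Z j).trace.re + (A j * (Z j)⁻¹).trace.re - 2 * fidelity Y (A j)) = 0 :=
      le_antisymm (by rw [← hgap Y hY]; exact sub_nonpos.2 (hYmin X hXp))
        (Finset.sum_nonneg fun j _ ↦ hterm Y hY j)
    -- One vanishing gap already determines Y; weights summing to 1 rule out m = 0.
    obtain ⟨j⟩ : Nonempty (Fin m) := by
      by_contra hm
      rw [not_nonempty_iff] at hm
      simp at hw1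
    have hj := (Finset.sum_eq_zero_iff_of_nonneg fun j _ ↦ hterm Y hY j).1 h0 j
      (Finset.mem_univ j)
    have hYZ := (two_mul_fidelity_eq_iff hY (hA j) (hZ j)).1
      (by have := (mul_eq_zero.1 hj).resolve_left (hw j).ne'; linarith)
    have := (hYZ.trans (hZX j).symm)
    exact (hZ j).isUnit.mul_left_cancel ((hZ j).isUnit.mul_right_cancel this)

end Barycentre

/-! ### Existence through the dual problem -/

section Existence

variable {n m : ℕ} {w : Fin m → ℝ} {A : Fin m → Matrix (Fin n) (Fin n) ℂ}

theorem isCompact_setOf_norm_apply_le (R : Fin m → ℝ) :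
    IsCompact {Z : Fin m → Matrix (Fin n) (Fin n) ℂ | ∀ j a b, ‖Z j a b‖ ≤ R j} := by
  have h : IsCompact (Set.univ.pi fun j : Fin m ↦ Set.univ.pi fun _ : Fin n ↦
      Set.univ.pi fun _ : Fin n ↦ Metric.closedBall (0 : ℂ) (R j)) :=
    isCompact_univ_pi fun j ↦ isCompact_univ_pi fun _ ↦ isCompact_univ_pi fun _ ↦
      isCompact_closedBall _ _
  refine h.of_isClosed_subset ?_ fun Z hZ ↦ ?_
  · simp only [Set.ofPred_forall]
    exact isClosed_iInter fun j ↦ isClosed_iInter fun a ↦ isClosed_iInter fun b ↦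
      isClosed_le (((continuous_apply j).matrix_elem a b).norm) continuous_const
  · exact fun j _ a _ b _ ↦ mem_closedBall_zero_iff.2 (hZ j a b)

/-- Pairs of tuples `(Z, V)` of mutually inverse positive matrices such that the `Zⱼ` average to
`1` and the dual objective `∑ⱼ wⱼ tr (Aⱼ Vⱼ)` is at most `c`. -/
def dualFeasible (w : Fin m → ℝ) (A : Fin m → Matrix (Fin n) (Fin n) ℂ) (c : ℝ) :
    Set ((Fin m → Matrix (Fin n) (Fin n) ℂ) × (Fin m → Matrix (Fin n) (Fin n) ℂ)) :=
  {p | (∀ j, (p.1 j).PosSemidef) ∧ (∀ j, (p.2 j).PosSemidef) ∧ (∀ j, p.1 j * p.2 j = 1) ∧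
    ∑ j, w j • p.1 j = 1 ∧ ∑ j, w j * (A j * p.2 j).trace.re ≤ c}

theorem continuous_dualObjective : Continuous
    fun p : (Fin m → Matrix (Fin n) (Fin n) ℂ) × (Fin m → Matrix (Fin n) (Fin n) ℂ) ↦
      ∑ j, w j * (A j * p.2 j).trace.re := by
  refine continuous_finsetSum _ fun j _ ↦ continuous_const.mul (Complex.continuous_re.comp ?_)
  exact (continuous_const.matrix_mul ((continuous_apply j).comp continuous_snd)).matrix_trace

/-- Carrying the inverses Vⱼ as variables is what gives closedness: semidefiniteness and Zⱼ Vⱼ = 1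
are closed conditions, yet together force Zⱼ to be positive definite. -/
theorem isClosed_dualFeasible (c : ℝ) : IsClosed (dualFeasible w A c) := by
  have h1 : ∀ j, Continuous fun p : (Fin m → Matrix (Fin n) (Fin n) ℂ) ×
      (Fin m → Matrix (Fin n) (Fin n) ℂ) ↦ p.1 j := fun j ↦ (continuous_apply j).comp continuous_fst
  have h2 : ∀ j, Continuous fun p : (Fin m → Matrix (Fin n) (Fin n) ℂ) ×
      (Fin m → Matrix (Fin n) (Fin n) ℂ) ↦ p.2 j := fun j ↦ (continuous_apply j).comp continuous_snd
  simp only [dualFeasible, Set.ofPred_and, Set.ofPred_forall]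
  refine (isClosed_iInter fun j ↦ Matrix.isClosed_setOf_posSemidef.preimage (h1 j)).inter
    ((isClosed_iInter fun j ↦ Matrix.isClosed_setOf_posSemidef.preimage (h2 j)).inter
      ((isClosed_iInter fun j ↦ isClosed_eq ((h1 j).matrix_mul (h2 j)) continuous_const).inter
        (IsClosed.inter (isClosed_eq ?_ continuous_const)
          (isClosed_le continuous_dualObjective continuous_const))))
  exact continuous_finsetSum _ fun j _ ↦ (h1 j).const_smul (w j)

/-- The constraint gives wⱼ tr Zⱼ ≤ n, and Aⱼ ≥ rⱼ gives wⱼ rⱼ tr Vⱼ ≤ c. -/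
theorem isCompact_dualFeasible (hw : ∀ j, 0 < w j) (hA : ∀ j, (A j).PosDef) (c : ℝ) :
    IsCompact (dualFeasible w A c) := by
  choose r hr hrA using fun j ↦ (hA j).exists_pos_algebraMap_le
  refine ((isCompact_setOf_norm_apply_le (n := n) fun j ↦ n / w j).prod
    (isCompact_setOf_norm_apply_le (n := n) fun j ↦ c / w j / r j)).of_isClosed_subset
    (isClosed_dualFeasible c) ?_
  rintro ⟨Z, V⟩ ⟨hZ, hV, -, hsum, hc⟩
  dsimp only at hZ hV hsum hc
  refine ⟨fun j a b ↦ ((hZ j).norm_apply_le_re_trace a b).trans ?_,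
    fun j a b ↦ ((hV j).norm_apply_le_re_trace a b).trans ?_⟩
  · have htr : ∑ j, w j * (Z j).trace.re = n := by
      have := congrArg (fun M ↦ M.trace.re) hsum
      simpa [Matrix.trace_sum] using this
    rw [le_div_iff₀ (hw j), mul_comm, ← htr]
    exact Finset.single_le_sum (f := fun j ↦ w j * (Z j).trace.re)
      (fun k _ ↦ mul_nonneg (hw k).le (hZ k).re_trace_nonneg) (Finset.mem_univ j)
  · have h1 : w j * (A j * V j).trace.re ≤ c :=
      (Finset.single_le_sum (f := fun j ↦ w j * (A j * V j).trace.re)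
        (fun k _ ↦ mul_nonneg (hw k).le ((hA k).posSemidef.re_trace_mul_nonneg (hV k)))
        (Finset.mem_univ j)).trans hc
    have h2 : r j * (V j).trace.re ≤ (A j * V j).trace.re := by
      have := (Matrix.le_iff.1 (hrA j)).re_trace_mul_nonneg (hV j)
      rw [Algebra.algebraMap_eq_smul_one, Matrix.sub_mul, Matrix.smul_mul, Matrix.one_mul] at this
      simpa using this
    rw [le_div_iff₀ (hr j), le_div_iff₀ (hw j)]
    nlinarith [mul_le_mul_of_nonneg_left h2 (hw j).le]

/-- The dual objective `Z ↦ ∑ⱼ wⱼ tr (Aⱼ Zⱼ⁻¹)` attains its minimum over the positive definite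
tuples averaging to `1`. -/
theorem exists_dual_minimiser (hw : ∀ j, 0 < w j) (hw1 : ∑ j, w j = 1)
    (hA : ∀ j, (A j).PosDef) : ∃ Z : Fin m → Matrix (Fin n) (Fin n) ℂ,
      (∀ j, (Z j).PosDef) ∧ ∑ j, w j • Z j = 1 ∧
      ∀ Z' : Fin m → Matrix (Fin n) (Fin n) ℂ, (∀ j, (Z' j).PosDef) → ∑ j, w j • Z' j = 1 →
        ∑ j, w j * (A j * (Z j)⁻¹).trace.re ≤ ∑ j, w j * (A j * (Z' j)⁻¹).trace.re := by
  -- This is the dual objective at Zⱼ = 1, so its sublevel set is nonempty.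
  set c := ∑ j, w j * (A j).trace.re with hc
  have hne : (dualFeasible w A c).Nonempty :=
    ⟨(fun _ ↦ 1, fun _ ↦ 1), fun _ ↦ Matrix.PosSemidef.one, fun _ ↦ Matrix.PosSemidef.one,
      fun _ ↦ Matrix.mul_one 1, by simp [← Finset.sum_smul, hw1], by simp [hc]⟩
  obtain ⟨⟨Z, V⟩, ⟨hZ, hV, hZV, hsum, hle⟩, hmin⟩ :=
    (isCompact_dualFeasible hw hA c).exists_isMinOn hne
      (continuous_dualObjective (w := w) (A := A)).continuousOn
  dsimp only at hZ hV hZV hsum hle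
  have hinv : ∀ j, (Z j)⁻¹ = V j := fun j ↦ Matrix.inv_eq_right_inv (hZV j)
  refine ⟨Z, fun j ↦ (hZ j).posDef_iff_isUnit.2 (IsUnit.of_mul_eq_one _ (hZV j)), hsum,
    fun Z' hZ' hsum' ↦ ?_⟩
  simp only [hinv]
  by_cases h : ∑ j, w j * (A j * (Z' j)⁻¹).trace.re ≤ c
  · exact hmin (a := (Z', fun j ↦ (Z' j)⁻¹)) ⟨fun j ↦ (hZ' j).posSemidef,
      fun j ↦ (hZ' j).inv.posSemidef, fun j ↦ (hZ' j).mul_inv, hsum', h⟩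
  · exact hle.trans (not_le.1 h).le

theorem Matrix.PosDef.tendsto_inv_add_smul {Z : Matrix (Fin n) (Fin n) ℂ} (hZ : Z.PosDef)
    (H : Matrix (Fin n) (Fin n) ℂ) : Tendsto (fun t : ℝ ↦ (Z + t • H)⁻¹) (𝓝 0) (𝓝 Z⁻¹) := by
  have hdet : Z.det ≠ 0 := ((Matrix.isUnit_iff_isUnit_det Z).1 hZ.isUnit).ne_zero
  have h1 : ContinuousAt Inv.inv Z := continuousAt_matrix_inv Z (by
    simpa only [Ring.inverse_eq_inv'] using continuousAt_inv₀ hdet)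
  have h2 : Tendsto (fun t : ℝ ↦ Z + t • H) (𝓝 0) (𝓝 Z) := by
    have : Continuous fun t : ℝ ↦ Z + t • H :=
      continuous_const.add (continuous_id.smul continuous_const)
    simpa using this.tendsto 0
  exact h1.tendsto.comp h2

theorem Matrix.PosDef.inv_add_smul {Z H : Matrix (Fin n) (Fin n) ℂ} (hZ : Z.PosDef) {t : ℝ}
    (h : (Z + t • H).PosDef) : (Z + t • H)⁻¹ = Z⁻¹ - t • (Z⁻¹ * H * (Z + t • H)⁻¹) := by
  calc (Z + t • H)⁻¹ = Z⁻¹ * (Z + t • H - t • H) * (Z + t • H)⁻¹ := by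
        rw [add_sub_cancel_right, hZ.inv_mul, Matrix.one_mul]
    _ = Z⁻¹ * ((Z + t • H) * (Z + t • H)⁻¹) - t • (Z⁻¹ * H * (Z + t • H)⁻¹) := by
        simp only [Matrix.mul_sub, Matrix.sub_mul, Matrix.mul_smul, Matrix.smul_mul,
          Matrix.mul_assoc]
    _ = _ := by rw [h.mul_inv, Matrix.mul_one]

/-- First-order condition: at a minimiser of the dual objective all the matrices
`Zⱼ⁻¹ Aⱼ Zⱼ⁻¹` agree. -/
theorem dual_minimiser_stationary (hw : ∀ j, 0 < w j) (hA : ∀ j, (A j).PosDef)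
    {Z : Fin m → Matrix (Fin n) (Fin n) ℂ} (hZ : ∀ j, (Z j).PosDef) (hsum : ∑ j, w j • Z j = 1)
    (hmin : ∀ Z' : Fin m → Matrix (Fin n) (Fin n) ℂ, (∀ j, (Z' j).PosDef) →
      ∑ j, w j • Z' j = 1 →
        ∑ j, w j * (A j * (Z j)⁻¹).trace.re ≤ ∑ j, w j * (A j * (Z' j)⁻¹).trace.re)
    (i k : Fin m) : (Z i)⁻¹ * A i * (Z i)⁻¹ = (Z k)⁻¹ * A k * (Z k)⁻¹ := by
  rcases eq_or_ne i k with rfl | hik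
  · rfl
  set H := (Z i)⁻¹ * A i * (Z i)⁻¹ - (Z k)⁻¹ * A k * (Z k)⁻¹ with hHdef
  have hH : H.IsHermitian :=
    ((hZ i).inv.mul_mul_self (hA i)).isHermitian.sub ((hZ k).inv.mul_mul_self (hA k)).isHermitian
  -- Moving Zᵢ along H / wᵢ and Zₖ along -H / wₖ preserves the constraint.
  let u : Fin m → ℝ := fun j ↦ if j = i then (w i)⁻¹ else if j = k then -(w k)⁻¹ else 0
  have hui : u i = (w i)⁻¹ := if_pos rfl
  have huk : u k = -(w k)⁻¹ := by simp [u, hik.symm]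
  have hu0 : ∀ j, j ≠ i ∧ j ≠ k → u j = 0 := fun j hj ↦ by simp [u, hj.1, hj.2]
  have hwi := (hw i).ne'
  have hwk := (hw k).ne'
  have hwu : ∑ j, w j * u j = 0 := by
    rw [Fintype.sum_eq_add i k hik fun j hj ↦ by rw [hu0 j hj, mul_zero], hui, huk]
    field_simp
    simp
  -- By the resolvent identity, φ t is minus the difference quotient of the dual objective, so
  -- minimality gives φ t ≤ 0 for small t > 0. Its limit at 0 is tr H², which forces H = 0.
  let φ : ℝ → ℝ := fun t ↦
    ∑ j, w j * (A j * ((Z j)⁻¹ * (u j • H) * (Z j + t • u j • H)⁻¹)).trace.re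
  have hφlim : Tendsto φ (𝓝[>] 0)
      (𝓝 (∑ j, w j * (A j * ((Z j)⁻¹ * (u j • H) * (Z j)⁻¹)).trace.re)) := by
    refine tendsto_finsetSum _ fun j _ ↦ ?_
    have hcont : Continuous fun V : Matrix (Fin n) (Fin n) ℂ ↦
        w j * (A j * ((Z j)⁻¹ * (u j • H) * V)).trace.re :=
      continuous_const.mul (Complex.continuous_re.comp
        (continuous_const.matrix_mul (continuous_const.matrix_mul continuous_id)).matrix_trace)
    exact (hcont.tendsto _).comp
      (((hZ j).tendsto_inv_add_smul (u j • H)).mono_left nhdsWithin_le_nhds)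
  have hφ : ∀ᶠ t in 𝓝[>] (0 : ℝ), φ t ≤ 0 := by
    have hpd : ∀ᶠ t in 𝓝[>] (0 : ℝ), ∀ j, (Z j + t • u j • H).PosDef :=
      nhdsWithin_le_nhds (eventually_all.2 fun j ↦ (hZ j).eventually_add_smul
        (H := u j • H) (IsSelfAdjoint.smul (IsSelfAdjoint.all (u j)) hH))
    filter_upwards [hpd, self_mem_nhdsWithin] with t ht (ht0 : 0 < t)
    have hsum' : ∑ j, w j • (Z j + t • u j • H) = 1 := by
      have : ∑ j, w j • t • u j • H = t • (∑ j, w j * u j) • H := by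
        rw [Finset.sum_smul, Finset.smul_sum]
        exact Finset.sum_congr rfl fun j _ ↦ by rw [smul_comm, mul_smul]
      simp only [smul_add, Finset.sum_add_distrib]
      rw [hsum, this, hwu, zero_smul, smul_zero, add_zero]
    have hle := hmin _ ht hsum'
    have hval : ∑ j, w j * (A j * (Z j + t • u j • H)⁻¹).trace.re =
        ∑ j, w j * (A j * (Z j)⁻¹).trace.re - t * φ t := by
      simp only [φ, Finset.mul_sum]
      rw [← Finset.sum_sub_distrib]
      refine Finset.sum_congr rfl fun j _ ↦ ?_
      conv_lhs => rw [(hZ j).inv_add_smul (ht j)]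
      rw [Matrix.mul_sub, Matrix.mul_smul, Matrix.trace_sub, Matrix.trace_smul, Complex.sub_re,
        Complex.smul_re, smul_eq_mul]
      ring
    nlinarith
  have hlim0 := le_of_tendsto hφlim hφ
  have hcyc : ∀ j, (A j * ((Z j)⁻¹ * H * (Z j)⁻¹)).trace =
      ((Z j)⁻¹ * A j * (Z j)⁻¹ * H).trace := fun j ↦ by
    rw [← Matrix.mul_assoc, Matrix.trace_mul_comm (A j * ((Z j)⁻¹ * H))]
    simp only [Matrix.mul_assoc]
  have hterm : ∀ j, w j * (A j * ((Z j)⁻¹ * (u j • H) * (Z j)⁻¹)).trace.re =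
      w j * u j * ((Z j)⁻¹ * A j * (Z j)⁻¹ * H).trace.re := fun j ↦ by
    rw [Matrix.mul_smul, Matrix.smul_mul, Matrix.mul_smul, Matrix.trace_smul, Complex.smul_re,
      smul_eq_mul, hcyc j, ← mul_assoc (w j)]
  simp only [hterm] at hlim0
  rw [Fintype.sum_eq_add i k hik fun j hj ↦ by rw [hu0 j hj, mul_zero, zero_mul], hui, huk,
    mul_inv_cancel₀ hwi, mul_neg, mul_inv_cancel₀ hwk, one_mul, neg_one_mul, ← sub_eq_add_neg,
    ← Complex.sub_re, ← Matrix.trace_sub, ← Matrix.sub_mul, ← hHdef] at hlim0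
  have hsq : Hᴴ * 1 * H = H * H := by rw [hH.eq, Matrix.mul_one]
  have hnonneg := (Matrix.posSemidef_conjTranspose_mul_self H).re_trace_nonneg
  rw [hH.eq] at hnonneg
  exact sub_eq_zero.1 (Matrix.PosDef.one.eq_zero_of_re_trace
    (by rw [hsq]; exact le_antisymm hlim0 hnonneg))

theorem exists_isBarycentreEquationSolution (hw : ∀ j, 0 < w j) (hw1 : ∑ j, w j = 1)
    (hA : ∀ j, (A j).PosDef) : ∃ X, IsBarycentreEquationSolution w A X := by
  obtain ⟨Z, hZ, hsum, hmin⟩ := exists_dual_minimiser hw hw1 hA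
  obtain ⟨i⟩ : Nonempty (Fin m) := by
    by_contra hm
    rw [not_nonempty_iff] at hm
    simp at hw1
  refine ⟨(Z i)⁻¹ * A i * (Z i)⁻¹, (isBarycentreEquationSolution_iff hA).2
    ⟨(hZ i).inv.mul_mul_self (hA i), Z, hZ, fun j ↦ ?_, hsum⟩⟩
  rw [dual_minimiser_stationary hw hA hZ hsum hmin i j]
  calc _ = (Z j * (Z j)⁻¹) * A j * ((Z j)⁻¹ * Z j) := by simp only [Matrix.mul_assoc]
    _ = A j := by rw [(hZ j).mul_inv, (hZ j).inv_mul, Matrix.one_mul, Matrix.mul_one]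

end Existence

theorem theorem8 {n m : ℕ} (w : Fin m → ℝ) (hw : ∀ j, 0 < w j) (hw1 : ∑ j, w j = 1)
    (A : Fin m → Matrix (Fin n) (Fin n) ℂ) (hA : ∀ j, (A j).PosDef) :
    ∃ Ω : Matrix (Fin n) (Fin n) ℂ,
      IsWassersteinBarycentre w A Ω ∧
      (∀ X, IsWassersteinBarycentre w A X → X = Ω) ∧
      IsBarycentreEquationSolution w A Ω ∧
      (∀ X, IsBarycentreEquationSolution w A X → X = Ω) := by
  obtain ⟨Ω, hΩ⟩ := exists_isBarycentreEquationSolution hw hw1 hA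
  obtain ⟨hmin, huniq⟩ := hΩ.isWassersteinBarycentre_and_unique hw hw1 hA
  exact ⟨Ω, hmin, huniq, hΩ, fun X hX ↦
    huniq X (hX.isWassersteinBarycentre_and_unique hw hw1 hA).1⟩
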